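/- Let $X$ be a complex Banach space and $L(X)$ the algebra of bounded linear operators on $X$. For $A\subset\mathbb{C}$ let $\mathrm{acc}\,A$ be the set of accumulation points of $A$, and define by transfinite recursion $\mathrm{acc}^{0}A=A$, $\mathrm{acc}^{\alpha+1}A=\mathrm{acc}(\mathrm{acc}^{\alpha}A)$ and $\mathrm{acc}^{\alpha}A=\bigcap_{\beta<\alpha}\mathrm{acc}^{\beta}A$ if $\alpha$ is a limit ordinal. Let $\sigma_*$ be one of the spectrum $\sigma$, the Browder spectrum $\sigma_b$, the Drazin spectrum $\sigma_d$, where $\sigma_b(T)$ (resp. $\sigma_d(T)$) is the set of $\lambda\in\mathbb{C}$ such that $T-\lambda I$ is not Browder (resp. not Drazin invertible); an operator $R$ is Browder if it is Fredholm of finite ascent and finite descent, and it is Drazin invertible if there are a bounded operator $S$ and $k\ge 0$ with $SR=RS$, $SRS=S$ and $R^{k+1}S=R^{k}$. An operator $T\in L(X)$ is called $g^{\alpha}_{\sigma_*}$-invertible, for an ordinal $\alpha$, - if $\alpha=0$: when $0\notin\sigma_*(T)$; - if $\alpha=\beta+1$ is a successor: when there are closed $T$-invariant subspaces $M,N$ with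 $X=M\oplus N$ such that the restriction $T_M$ is invertible in $L(M)$ and $\mathrm{acc}^{\beta}\sigma_*(T_N)\subset\{0\}$; - if $\alpha$ is a (nonzero) limit ordinal: when $T$ is $g^{\beta}_{\sigma_*}$-invertible for some successor ordinal $\beta<\alpha$. **Theorem.** For every $T\in L(X)$, every $\mu\in\mathbb{C}$, every ordinal $\alpha$ and each $\sigma_*\in\{\sigma,\sigma_b,\sigma_d\}$, the operator $T-\mu I$ is $g^{\alpha}_{\sigma_*}$-invertible if and only if $\mu\notin\mathrm{acc}^{\alpha}\sigma_*(T)$. -/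

import Mathlib

noncomputable section

/-- The `α`-th Cantor-Bendixson derivative of a set of complex numbers: `acc⁰ A = A`, `acc^(α+1) A`
is the set of accumulation points of `acc^α A`, and at a limit ordinal one intersects all the
previous derivatives. -/
def accIter (A : Set ℂ) (α : Ordinal) : Set ℂ :=
  Ordinal.limitRecOn (motive := fun _ => Set ℂ) α A
    (fun _ B => derivedSet B)
    (fun o _ B => ⋂ (β : Ordinal) (h : β < o), B β h)

theorem accIter_zero (A : Set ℂ) : accIter A 0 = A :=
  Ordinal.limitRecOn_zero _ _ _

theorem accIter_add_one (A : Set ℂ) (α : Ordinal) :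
    accIter A (α + 1) = derivedSet (accIter A α) :=
  Ordinal.limitRecOn_add_one _ _ _ _

theorem accIter_limit (A : Set ℂ) {α : Ordinal} (hα : Order.IsSuccLimit α) :
    accIter A α = ⋂ (β : Ordinal) (_ : β < α), accIter A β :=
  Ordinal.limitRecOn_limit _ _ _ _ hα

section Operators

variable {X : Type*} [NormedAddCommGroup X] [NormedSpace ℂ X]

/-- `T` has finite ascent: the increasing chain of the kernels of its powers becomes stationary. -/
def HasFiniteAscent (T : X →L[ℂ] X) : Prop :=
  ∃ p : ℕ, (T ^ p).ker = (T ^ (p + 1)).ker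

/-- `T` has finite descent: the decreasing chain of the ranges of its powers becomes stationary. -/
def HasFiniteDescent (T : X →L[ℂ] X) : Prop :=
  ∃ q : ℕ, (T ^ q).range = (T ^ (q + 1)).range

/-- Browder operators: Fredholm operators of finite ascent and finite descent. -/
def IsBrowder (T : X →L[ℂ] X) : Prop :=
  T.IsFredholm ∧ HasFiniteAscent T ∧ HasFiniteDescent T

/-- Drazin invertible operators: there is a bounded `S` commuting with `T` such that `STS = S` and
`T ^ (k + 1) S = T ^ k` for some `k`. -/
def IsDrazinInvertible (T : X →L[ℂ] X) : Prop :=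
  ∃ S : X →L[ℂ] X, Commute S T ∧ S * T * S = S ∧ ∃ k : ℕ, T ^ (k + 1) * S = T ^ k

/-- The three kinds of spectrum: ordinary, Browder and Drazin. -/
inductive SpectrumKind
  | ordinary
  | browder
  | drazin

/-- The spectrum `σ_*(T)`, where `σ_*` is the spectrum, the Browder spectrum or the Drazin
spectrum. -/
def SpectrumKind.spec : SpectrumKind → (X →L[ℂ] X) → Set ℂ
  | .ordinary, T => spectrum ℂ T
  | .browder, T => {z | ¬ IsBrowder (T - z • (1 : X →L[ℂ] X))}
  | .drazin, T => {z | ¬ IsDrazinInvertible (T - z • (1 : X →L[ℂ] X))}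

/-- `T = D ⊕ Q` along closed `T`-invariant subspaces `M`, `N` with `X = M ⊕ N`, where the
restriction `D` of `T` to `M` is invertible in `L(M)` and the restriction `Q` of `T` to `N`
satisfies `acc^β σ_*(Q) ⊆ {0}`. -/
def HasDecomposition (κ : SpectrumKind) (β : Ordinal) (T : X →L[ℂ] X) : Prop :=
  ∃ (M N : Submodule ℂ X) (hM : ∀ x ∈ M, T x ∈ M) (hN : ∀ x ∈ N, T x ∈ N),
    IsClosed (M : Set X) ∧ IsClosed (N : Set X) ∧ IsCompl M N ∧
    IsUnit (T.restrict hM : M →L[ℂ] M) ∧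
    accIter (κ.spec (T.restrict hN : N →L[ℂ] N)) β ⊆ {0}

/-- `T` is `g^α_{σ_*}`-invertible. The three alternatives are exclusive: `α = 0`, `α` is a
successor, `α` is a (nonzero) limit ordinal; in the last case `T` is required to be
`g^(γ+1)_{σ_*}`-invertible for some successor ordinal `γ + 1 < α`. -/
def IsGInvertible (κ : SpectrumKind) (α : Ordinal) (T : X →L[ℂ] X) : Prop :=
  (α = 0 ∧ (0 : ℂ) ∉ κ.spec T) ∨
  (∃ β : Ordinal, α = β + 1 ∧ HasDecomposition κ β T) ∨
  (Order.IsSuccLimit α ∧ ∃ γ : Ordinal, γ + 1 < α ∧ HasDecomposition κ γ T)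

end Operators

end

open Filter Topology Set

/-! After translating by `μ`, everything rests on the successor case at `0`: a decomposition with
`acc^β σ_*(T_N) ⊆ {0}` exists iff `0 ∉ acc^(β+1) σ_*(T)`.

Given a decomposition, `T_M - z` is invertible for `z` near `0`, so `σ_*(T)` is contained in
`σ_*(T_N)` near `0`. Derivatives are local, hence `acc^β σ_*(T)` has at most the point `0` there
(`Submodule.IsTopCompl.zero_notMem_accIter`).

Conversely, let `acc^β σ_*(T)` meet a ball around `0` in at most `{0}`. Each of the three kinds of
invertibility implies Drazin invertibility, so points of `σ(T)` outside `σ_*(T)` are isolated in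
`σ(T)`. The perfect kernel of `σ(T)` therefore lies in `σ_*(T)` and survives every derivation;
inside the ball it is at most `{0}`, so by Cantor-Bendixson `σ(T)` is countable there
(`countable_inter_of_accIter`). Some small circle around `0` then misses `σ(T)`, and the Riesz
projection for its disc splits `T` (`exists_isTopCompl_of_spectrum_disjoint_sphere`). Since
`σ_*(T_N)` lies both in `σ_*(T)` and in the disc, its derivative of order `β` is contained in `{0}`.

The Riesz projection is obtained without contour integrals, as the limit of `(1 - a ^ 2 ^ k)⁻¹`. -/

/-! ### Cantor-Bendixson derivatives of plane sets. -/

/-- Whether a point of an open set `U` is an accumulation point depends only on the part of the set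
inside `U`. -/
theorem accIter_inter_subset {A B U : Set ℂ} (hU : IsOpen U) (h : A ∩ U ⊆ B) (β : Ordinal) :
    accIter A β ∩ U ⊆ accIter B β := by
  induction β using Ordinal.limitRecOn with
  | zero => simpa only [accIter_zero] using h
  | add_one β ih =>
    rw [accIter_add_one, accIter_add_one]
    rintro x ⟨hx, hxU⟩
    refine derivedSet_mono _ _ ih ?_
    rw [inter_comm]
    exact AccPt.nhds_inter hx (hU.mem_nhds hxU)
  | limit β hβ ih =>
    rw [accIter_limit _ hβ, accIter_limit _ hβ]
    rintro x ⟨hx, hxU⟩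
    simp only [mem_iInter] at hx ⊢
    exact fun γ hγ => ih γ hγ ⟨hx γ hγ, hxU⟩

theorem accIter_mono {A B : Set ℂ} (h : A ⊆ B) (β : Ordinal) : accIter A β ⊆ accIter B β := by
  simpa using accIter_inter_subset isOpen_univ (by simpa using h) β

theorem isClosed_accIter {A : Set ℂ} (hA : IsClosed A) (β : Ordinal) :
    IsClosed (accIter A β) := by
  induction β using Ordinal.limitRecOn with
  | zero => rwa [accIter_zero]
  | add_one β ih => rw [accIter_add_one]; exact isClosed_derivedSet _
  | limit β hβ ih =>
    rw [accIter_limit _ hβ]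
    exact isClosed_iInter fun γ => isClosed_iInter fun hγ => ih γ hγ

theorem accIter_add_one_subset {A : Set ℂ} (hA : IsClosed A) (β : Ordinal) :
    accIter A (β + 1) ⊆ accIter A β := by
  rw [accIter_add_one]
  exact (isClosed_iff_derivedSet_subset _).1 (isClosed_accIter hA β)

theorem accIter_subset {A : Set ℂ} (hA : IsClosed A) (β : Ordinal) : accIter A β ⊆ A := by
  induction β using Ordinal.limitRecOn with
  | zero => rw [accIter_zero]
  | add_one β ih => exact (accIter_add_one_subset hA β).trans ih
  | limit β hβ ih =>
    rw [accIter_limit _ hβ]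
    intro x hx
    simp only [mem_iInter] at hx
    simpa only [accIter_zero] using hx 0 hβ.bot_lt

theorem notMem_accIter_add_one {A U : Set ℂ} (hU : IsOpen U) {c : ℂ} (hc : c ∈ U) {β : Ordinal}
    (h : accIter A β ∩ U ⊆ {c}) : c ∉ accIter A (β + 1) := by
  rw [accIter_add_one, mem_derivedSet, accPt_iff_nhds]
  intro h'
  obtain ⟨y, ⟨hyU, hy⟩, hyc⟩ := h' _ (hU.mem_nhds hc)
  exact hyc (h ⟨hy, hyU⟩)

theorem Preperfect.subset_accIter {A P : Set ℂ} (hP : Preperfect P) (h : P ⊆ A) (β : Ordinal) :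
    P ⊆ accIter A β := by
  induction β using Ordinal.limitRecOn with
  | zero => rwa [accIter_zero]
  | add_one β ih =>
    rw [accIter_add_one]
    exact (preperfect_iff_subset_derivedSet.1 hP).trans (derivedSet_mono _ _ ih)
  | limit β hβ ih =>
    rw [accIter_limit _ hβ]
    exact subset_iInter fun γ => subset_iInter fun hγ => ih γ hγ

theorem Homeomorph.derivedSet_preimage {X Y : Type*} [TopologicalSpace X] [TopologicalSpace Y]
    (e : X ≃ₜ Y) (A : Set Y) : derivedSet (e ⁻¹' A) = e ⁻¹' derivedSet A := by
  apply Subset.antisymm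
  · rw [← image_subset_iff]
    refine (e.continuous.image_derivedSet e.injective).trans ?_
    rw [e.image_preimage]
  · have := e.symm.continuous.image_derivedSet (A := A) e.symm.injective
    simpa only [e.image_symm] using this

theorem accIter_preimage (e : ℂ ≃ₜ ℂ) (A : Set ℂ) (β : Ordinal) :
    accIter (e ⁻¹' A) β = e ⁻¹' accIter A β := by
  induction β using Ordinal.limitRecOn with
  | zero => simp only [accIter_zero]
  | add_one β ih => rw [accIter_add_one, accIter_add_one, ih, e.derivedSet_preimage]
  | limit β hβ ih =>
    rw [accIter_limit _ hβ, accIter_limit _ hβ]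
    simp only [preimage_iInter]
    exact iInter_congr fun γ => iInter_congr fun hγ => ih γ hγ

/-- If the points of a closed set `C` outside of `A` are isolated in `C` and a derivative of `A`
meets an open set `U` in at most one point, then `C ∩ U` is countable. -/
theorem countable_inter_of_accIter {A C U : Set ℂ} (hC : IsClosed C) {c : ℂ}
    (hiso : ∀ x ∈ C, x ∉ A → ¬ AccPt x (𝓟 C)) {β : Ordinal} (h : accIter A β ∩ U ⊆ {c}) :
    (C ∩ U).Countable := by
  obtain ⟨V, P, hV, hP, rfl⟩ := exists_countable_union_perfect_of_isClosed hC
  -- A point of the perfect kernel accumulates at `P`, hence at `C`, so it cannot lie outside `A`.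
  have hPA : P ⊆ A := fun x hx => by
    by_contra hxA
    exact hiso x (Or.inr hx) hxA ((hP.acc x hx).mono (principal_mono.2 subset_union_right))
  refine (hV.union (countable_singleton c)).mono ?_
  rintro x ⟨hx | hx, hxU⟩
  · exact Or.inl hx
  · exact Or.inr (h ⟨hP.acc.subset_accIter hPA β hx, hxU⟩)

theorem exists_sphere_disjoint {C : Set ℂ} {ε : ℝ} (hε : 0 < ε)
    (hC : (C ∩ Metric.ball 0 ε).Countable) :
    ∃ r, 0 < r ∧ r < ε ∧ ∀ z ∈ C, ‖z‖ ≠ r := by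
  have h1 : ¬ (Ioo 0 ε).Countable := by
    rw [← Cardinal.le_aleph0_iff_set_countable, Cardinal.mk_Ioo_real hε, not_le]
    exact Cardinal.aleph0_lt_continuum
  -- Countably many points occupy only countably many radii.
  have h2 : ¬ Ioo 0 ε ⊆ norm '' (C ∩ Metric.ball 0 ε) := fun h => h1 ((hC.image _).mono h)
  obtain ⟨r, hr, hr'⟩ := not_subset.1 h2
  refine ⟨r, hr.1, hr.2, fun z hz hzr => hr' ⟨z, ⟨hz, ?_⟩, hzr⟩⟩
  rw [mem_ball_zero_iff, hzr]
  exact hr.2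

/-! ### Idempotents and Drazin inverses in rings. -/

/-- The inverse is glued from the two corners: `x⁻¹ e + y⁻¹ (1 - e)`. -/
theorem IsIdempotentElem.isUnit_of_mul_eq {R : Type*} [Ring R] {e x y z : R}
    (he : IsIdempotentElem e) (hx : IsUnit x) (hy : IsUnit y) (hex : Commute e x)
    (hey : Commute e y) (hxz : x * e = z * e) (hyz : y * (1 - e) = z * (1 - e)) :
    IsUnit z := by
  obtain ⟨x, rfl⟩ := hx
  obtain ⟨y, rfl⟩ := hy
  have hz : z = x * e + y * (1 - e) := by rw [hxz, hyz]; noncomm_ring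
  have h1 : e * (1 - e) = 0 := he.mul_one_sub_self
  have h2 : (1 - e) * e = 0 := he.one_sub_mul_self
  have h3 : (1 - e) * (1 - e) = 1 - e := he.one_sub
  have h4 : Commute e (↑x⁻¹ : R) := hex.units_inv_right
  have h5 : Commute (1 - e) (↑y⁻¹ : R) := (Commute.one_left _).sub_left hey.units_inv_right
  have h6 : Commute (1 - e) (y : R) := (Commute.one_left _).sub_left hey
  have hleft : (↑x⁻¹ * e + ↑y⁻¹ * (1 - e)) * z = 1 := by
    calc (↑x⁻¹ * e + ↑y⁻¹ * (1 - e)) * z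
        = ↑x⁻¹ * (e * x) * e + ↑x⁻¹ * (e * y) * (1 - e) + ↑y⁻¹ * ((1 - e) * x) * e
          + ↑y⁻¹ * ((1 - e) * y) * (1 - e) := by rw [hz]; noncomm_ring
      _ = ↑x⁻¹ * ↑x * (e * e) + ↑x⁻¹ * y * (e * (1 - e)) + ↑y⁻¹ * x * ((1 - e) * e)
          + ↑y⁻¹ * y * ((1 - e) * (1 - e)) := by
        rw [hex.eq, hey.eq, h6.eq, ((Commute.one_left (x : R)).sub_left hex).eq]; noncomm_ring
      _ = 1 := by rw [h1, h2, h3, he.eq]; simp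
  have hright : z * (↑x⁻¹ * e + ↑y⁻¹ * (1 - e)) = 1 := by
    calc z * (↑x⁻¹ * e + ↑y⁻¹ * (1 - e))
        = x * (e * ↑x⁻¹) * e + x * (e * ↑y⁻¹) * (1 - e) + y * ((1 - e) * ↑x⁻¹) * e
          + y * ((1 - e) * ↑y⁻¹) * (1 - e) := by rw [hz]; noncomm_ring
      _ = x * ↑x⁻¹ * (e * e) + x * ↑y⁻¹ * (e * (1 - e)) + y * ↑x⁻¹ * ((1 - e) * e)
          + y * ↑y⁻¹ * ((1 - e) * (1 - e)) := by
        rw [h4.eq, hey.units_inv_right.eq, h5.eq,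
          ((Commute.one_left (↑x⁻¹ : R)).sub_left h4).eq]; noncomm_ring
      _ = 1 := by rw [h1, h2, h3, he.eq]; simp
  exact ⟨⟨z, _, hright, hleft⟩, rfl⟩

section DrazinInverse

variable {R : Type*} [Ring R] {s t : R} {k : ℕ}

theorem isIdempotentElem_mul_of_drazin (h : s * t * s = s) : IsIdempotentElem (t * s) := by
  rw [IsIdempotentElem, mul_assoc, ← mul_assoc s, h]

/-- A Drazin inverse lies in the double commutant. -/
theorem Commute.drazin_inverse (hst : Commute s t) (h : s * t * s = s)
    (hk : t ^ (k + 1) * s = t ^ k) {p : R} (hp : Commute p t) : Commute p s := by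
  have he := isIdempotentElem_mul_of_drazin h
  have hk0 : t ^ (k + 1) * (1 - t * s) = 0 := by
    rw [mul_sub, mul_one, ← mul_assoc, ← pow_succ, pow_succ' t (k + 1), mul_assoc, hk,
      ← pow_succ', sub_self]
  have heq : t ^ (k + 1) * s ^ (k + 1) = t * s := by
    rw [← hst.symm.mul_pow]; exact he.pow_succ_eq k
  have heq' : s ^ (k + 1) * t ^ (k + 1) = t * s := by
    rw [← heq, (hst.symm.pow_pow _ _).eq]
  have hk0' : (1 - t * s) * t ^ (k + 1) = 0 := by
    have : Commute (1 - t * s) (t ^ (k + 1)) :=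
      (Commute.one_left _).sub_left (((Commute.refl t).mul_left hst).pow_right _)
    rw [this.eq, hk0]
  have hpk := (hp.pow_right (k + 1)).eq
  -- Both off-diagonal corners of `p` vanish: `t s` contains a factor `t ^ (k + 1)`, which passes
  -- through `p` and annihilates `1 - t s`.
  have h1 : t * s * p * (1 - t * s) = 0 := by
    rw [← heq', mul_assoc _ _ p, ← hpk, mul_assoc, mul_assoc p, heq', hk0, mul_zero, mul_zero]
  have h2 : (1 - t * s) * p * (t * s) = 0 := by
    rw [← heq, ← mul_assoc, mul_assoc _ p, hpk, ← mul_assoc, heq, hk0', zero_mul, zero_mul]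
  have h3 : t * s * p = p * (t * s) := by
    have h1' : t * s * p = t * s * p * (t * s) := by
      rw [← sub_eq_zero, ← h1]; noncomm_ring
    have h2' : p * (t * s) = t * s * p * (t * s) := by
      rw [← sub_eq_zero, ← h2]; noncomm_ring
    rw [h1', ← h2']
  have h4 : s = s * (t * s) := by rw [← mul_assoc, h]
  have h5 : s = t * s * s := by rw [← hst.eq, h]
  calc p * s = p * (t * s) * s := by rw [mul_assoc, ← h5]
    _ = t * s * p * s := by rw [h3]
    _ = s * (t * p) * s := by rw [← hst.eq]; simp only [mul_assoc]
    _ = s * (p * (t * s)) := by rw [← hp.eq]; simp only [mul_assoc]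
    _ = s * (t * s) * p := by rw [← h3, mul_assoc s]
    _ = s * p := by rw [← h4]

/-- With `e = t s`, `t` is invertible on the corner of `e`, which persists for small `z`, and
nilpotent on that of `1 - e`, where subtracting any `z ≠ 0` gives a unit. -/
theorem eventually_isUnit_sub_of_drazin {A : Type*} [NormedRing A] [NormedAlgebra ℂ A]
    [CompleteSpace A] {s t : A} (hst : Commute s t) (h : s * t * s = s)
    (hk : t ^ (k + 1) * s = t ^ k) : ∀ᶠ z : ℂ in 𝓝[≠] 0, IsUnit (t - z • (1 : A)) := by
  have he := isIdempotentElem_mul_of_drazin h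
  set e := t * s with hedef
  have het : Commute e t := (Commute.refl t).mul_left hst
  have h5 : e * s = s := by rw [hedef, ← hst.eq, h]
  have h6 : s * e = s := by rw [hedef, ← mul_assoc, h]
  have h7 : s * t = e := hst.eq
  clear_value e
  have ha : IsUnit (t * e + (1 - e)) := by
    refine ⟨⟨t * e + (1 - e), s + (1 - e), ?_, ?_⟩, rfl⟩
    · calc (t * e + (1 - e)) * (s + (1 - e))
          = t * (e * s) + t * (e - e * e) + s - e * s + (1 - e) - (e - e * e) := by noncomm_ring
        _ = 1 := by rw [h5, he.eq, ← hedef]; simp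
    · calc (s + (1 - e)) * (t * e + (1 - e))
          = s * t * e + s - s * e + t * e - e * t * e + (1 - e) - (e - e * e) := by noncomm_ring
        _ = 1 := by rw [h7, h6, het.eq, mul_assoc t, he.eq]; simp
  have hn : IsNilpotent (t * (1 - e)) := by
    -- The exponent `k` would fail for `k = 0`, since `(1 - e) ^ 0 = 1`.
    refine ⟨k + 1, ?_⟩
    have hc : Commute t (1 - e) := (Commute.one_right _).sub_right het.symm
    rw [hc.mul_pow, he.one_sub.pow_succ_eq k, mul_sub, mul_one, hedef, ← mul_assoc, ← pow_succ,
      pow_succ' t (k + 1), mul_assoc, hk, ← pow_succ', sub_self]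
  have hcont : Tendsto (fun z : ℂ => t * e + (1 - e) - z • (1 : A)) (𝓝 0)
      (𝓝 (t * e + (1 - e) - (0 : ℂ) • (1 : A))) := by
    apply Continuous.tendsto; fun_prop
  rw [zero_smul, sub_zero] at hcont
  have hev := hcont.eventually (Units.isOpen.mem_nhds ha)
  filter_upwards [hev.filter_mono nhdsWithin_le_nhds, self_mem_nhdsWithin] with z hz hz0
  have hzu : IsUnit (z • (1 : A)) := by
    rw [← Algebra.algebraMap_eq_smul_one]
    exact (isUnit_iff_ne_zero.2 hz0).map (algebraMap ℂ A)
  have hu : IsUnit (t * (1 - e) - z • (1 : A)) := by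
    have : Commute (t * (1 - e)) (z • (1 : A)) := (Commute.one_right _).smul_right z
    have h8 := hn.neg.isUnit_add_left_of_commute hzu this.neg_left
    rw [← IsUnit.neg_iff]
    convert h8 using 1
    abel
  have hce : Commute e (z • (1 : A)) := (Commute.one_right _).smul_right z
  refine he.isUnit_of_mul_eq hz hu ?_ ?_ ?_ ?_
  · exact ((het.mul_right (Commute.refl e)).add_right
      ((Commute.one_right _).sub_right (Commute.refl e))).sub_right hce
  · exact (het.mul_right ((Commute.one_right _).sub_right (Commute.refl e))).sub_right hce
  · calc (t * e + (1 - e) - z • (1 : A)) * e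
        = t * (e * e) + (e - e * e) - z • (1 : A) * e := by noncomm_ring
      _ = (t - z • (1 : A)) * e := by rw [he.eq]; noncomm_ring
  · rw [sub_mul, sub_mul, mul_assoc, he.one_sub.eq]

end DrazinInverse

/-! ### The Riesz projection as a limit of resolvents. -/

/-- Here `‖u - v‖ = ‖z + w‖ ‖z - w‖`. By the parallelogram law one of `‖z ± w‖` is at least `√2 > 4
/ 3`; the sign of `w` is chosen accordingly. -/
theorem Complex.exists_sq_eq_sq_eq_norm_sub_le {u v : ℂ} (hu : ‖u‖ = 1) (hv : ‖v‖ = 1) :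
    ∃ z w : ℂ, ‖z‖ = 1 ∧ ‖w‖ = 1 ∧ z ^ 2 = u ∧ w ^ 2 = v ∧ ‖z - w‖ ≤ 3 / 4 * ‖u - v‖ := by
  have hsq : ∀ {x y : ℂ}, x ^ 2 = y → ‖y‖ = 1 → ‖x‖ = 1 := fun {x y} h hy => by
    rw [← h, norm_pow] at hy
    exact (pow_eq_one_iff_of_nonneg (norm_nonneg _) two_ne_zero).1 hy
  have key : ∀ {z w : ℂ}, z ^ 2 = u → w ^ 2 = v → 4 / 3 ≤ ‖z + w‖ →
      ‖z - w‖ ≤ 3 / 4 * ‖u - v‖ := fun {z w} hz hw h => by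
    have : ‖u - v‖ = ‖z + w‖ * ‖z - w‖ := by rw [← hz, ← hw, ← norm_mul, sq_sub_sq]
    rw [this]
    nlinarith [norm_nonneg (z - w)]
  obtain ⟨z, hz⟩ := IsAlgClosed.exists_pow_nat_eq u (n := 2) two_pos
  obtain ⟨w, hw⟩ := IsAlgClosed.exists_pow_nat_eq v (n := 2) two_pos
  have hz1 := hsq hz hu
  have hw1 := hsq hw hv
  by_cases h : 4 / 3 ≤ ‖z + w‖
  · exact ⟨z, w, hz1, hw1, hz, hw, key hz hw h⟩
  · have hw' : (-w) ^ 2 = v := by rw [neg_sq, hw]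
    refine ⟨z, -w, hz1, by rwa [norm_neg], hz, hw', key hz hw' ?_⟩
    have hpar := parallelogram_law_with_norm ℝ z w
    rw [hz1, hw1] at hpar
    rw [← sub_eq_add_neg]
    nlinarith [norm_nonneg (z + w), norm_nonneg (z - w)]

theorem Ring.inverse_one_sub_sq {R : Type*} [Ring R] [Algebra ℂ R] {x : R}
    (h1 : IsUnit (1 - x)) (h2 : IsUnit (1 + x)) :
    Ring.inverse (1 - x ^ 2) = (2⁻¹ : ℂ) • (Ring.inverse (1 - x) + Ring.inverse (1 + x)) := by
  have hf : 1 - x ^ 2 = (1 - x) * (1 + x) := by noncomm_ring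
  have hf' : 1 - x ^ 2 = (1 + x) * (1 - x) := by noncomm_ring
  have hu : IsUnit (1 - x ^ 2) := hf ▸ h1.mul h2
  refine hu.mul_right_cancel ?_
  rw [Ring.inverse_mul_cancel _ hu, smul_mul_assoc, add_mul]
  nth_rw 1 [hf]
  rw [hf', Ring.inverse_mul_cancel_left _ _ h1, Ring.inverse_mul_cancel_left _ _ h2]
  have : (1 + x) + (1 - x) = (2 : ℂ) • (1 : R) := by rw [two_smul]; abel
  rw [this, smul_smul]
  norm_num

section RieszProjection

variable {A : Type*} [NormedRing A] [NormedAlgebra ℂ A] {a : A}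

theorem isUnit_one_sub_smul_pow (h : ∀ z ∈ spectrum ℂ a, ‖z‖ ≠ 1) {n : ℕ} (hn : 0 < n) {z : ℂ}
    (hz : ‖z‖ = 1) : IsUnit (1 - z • a ^ n) := by
  have hz0 : z ≠ 0 := fun h0 => by simp [h0] at hz
  by_contra hu
  have hmem : z⁻¹ ∈ spectrum ℂ (a ^ n) := by
    rw [spectrum.mem_iff, Algebra.algebraMap_eq_smul_one]
    intro hu'
    apply hu
    have : 1 - z • a ^ n = (Units.mk0 z hz0) • (z⁻¹ • (1 : A) - a ^ n) := by
      rw [Units.smul_def, Units.val_mk0, smul_sub, smul_smul, mul_inv_cancel₀ hz0, one_smul]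
    rw [this]
    exact hu'.smul _
  rw [spectrum.map_pow_of_pos a hn] at hmem
  obtain ⟨w, hw, hwz⟩ := hmem
  refine h w hw ?_
  have h1 : ‖w‖ ^ n = 1 := by
    rw [← norm_pow]
    simpa [hz] using congrArg norm hwz
  exact (pow_eq_one_iff_of_nonneg (norm_nonneg _) hn.ne').1 h1

/-- The resolvent identity, with resolvents bounded on the compact circle. -/
theorem exists_lipschitz_inverse_one_sub_smul [CompleteSpace A]
    (h : ∀ z ∈ spectrum ℂ a, ‖z‖ ≠ 1) :
    ∃ L : ℝ, ∀ u v : ℂ, ‖u‖ = 1 → ‖v‖ = 1 →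
      ‖Ring.inverse (1 - u • a) - Ring.inverse (1 - v • a)‖ ≤ L * ‖u - v‖ := by
  have hunit : ∀ u : ℂ, ‖u‖ = 1 → IsUnit (1 - u • a) := fun u hu => by
    simpa using isUnit_one_sub_smul_pow h one_pos hu
  have hcont : ContinuousOn (fun u : ℂ => Ring.inverse (1 - u • a)) (Metric.sphere 0 1) := by
    intro u hu
    obtain ⟨y, hy⟩ := hunit u (by simpa using hu)
    have h1 : ContinuousAt Ring.inverse (1 - u • a) := hy ▸ NormedRing.inverse_continuousAt y
    have h2 : ContinuousAt (fun u : ℂ => 1 - u • a) u := by fun_prop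
    exact (ContinuousAt.comp (f := fun u : ℂ => 1 - u • a) h1 h2).continuousWithinAt
  obtain ⟨C, hC⟩ := (isCompact_sphere (0 : ℂ) 1).exists_bound_of_continuousOn hcont
  refine ⟨C * ‖a‖ * C, fun u v hu hv => ?_⟩
  have hCu := hC u (by simpa using hu)
  have hCv := hC v (by simpa using hv)
  have hC0 : 0 ≤ C := (norm_nonneg _).trans hCu
  have heq : Ring.inverse (1 - u • a) - Ring.inverse (1 - v • a) =
      (u - v) • (Ring.inverse (1 - u • a) * a * Ring.inverse (1 - v • a)) := by
    have e1 : Ring.inverse (1 - u • a) =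
        Ring.inverse (1 - u • a) * (1 - v • a) * Ring.inverse (1 - v • a) := by
      rw [mul_assoc, Ring.mul_inverse_cancel _ (hunit v hv), mul_one]
    have e2 : Ring.inverse (1 - v • a) =
        Ring.inverse (1 - u • a) * (1 - u • a) * Ring.inverse (1 - v • a) := by
      rw [Ring.inverse_mul_cancel _ (hunit u hu), one_mul]
    nth_rw 1 [e1]
    nth_rw 2 [e2]
    rw [← sub_mul, ← mul_sub, sub_sub_sub_cancel_left, ← sub_smul, mul_smul_comm, smul_mul_assoc]
  rw [heq, norm_smul, mul_comm]
  gcongr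
  calc _ ≤ ‖Ring.inverse (1 - u • a)‖ * ‖a‖ * ‖Ring.inverse (1 - v • a)‖ := norm_mul₃_le
    _ ≤ C * ‖a‖ * C := by gcongr

/-- Squaring `a` averages the resolvents at `z` and `-z`, so the Lipschitz constant shrinks by the
contraction factor `3 / 4` of suitably chosen square roots. -/
theorem norm_inverse_one_sub_smul_pow_sub_le (h : ∀ z ∈ spectrum ℂ a, ‖z‖ ≠ 1) {L : ℝ}
    (hL : ∀ u v : ℂ, ‖u‖ = 1 → ‖v‖ = 1 →
      ‖Ring.inverse (1 - u • a) - Ring.inverse (1 - v • a)‖ ≤ L * ‖u - v‖) (k : ℕ) :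
    ∀ u v : ℂ, ‖u‖ = 1 → ‖v‖ = 1 →
      ‖Ring.inverse (1 - u • a ^ 2 ^ k) - Ring.inverse (1 - v • a ^ 2 ^ k)‖ ≤
        L * (3 / 4) ^ k * ‖u - v‖ := by
  have hL0 : 0 ≤ L := by
    have := (norm_nonneg _).trans (hL 1 (-1) (by simp) (by simp))
    have h2 : ‖(1 : ℂ) - -1‖ = 2 := by norm_num
    rw [h2] at this
    linarith
  induction k with
  | zero => simpa using hL
  | succ k ih =>
    have hsq : ∀ z : ℂ, ‖z‖ = 1 → Ring.inverse (1 - z ^ 2 • a ^ 2 ^ (k + 1)) = (2⁻¹ : ℂ) •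
        (Ring.inverse (1 - z • a ^ 2 ^ k) + Ring.inverse (1 - (-z) • a ^ 2 ^ k)) := by
      intro z hz
      have h1 := isUnit_one_sub_smul_pow h (n := 2 ^ k) (by positivity) hz
      have h2 := isUnit_one_sub_smul_pow h (n := 2 ^ k) (by positivity) (z := -z) (by simpa)
      rw [neg_smul, sub_neg_eq_add] at h2 ⊢
      rw [← Ring.inverse_one_sub_sq h1 h2, smul_pow, ← pow_mul, ← pow_succ]
    intro u v hu hv
    obtain ⟨z, w, hz, hw, rfl, rfl, hzw⟩ := Complex.exists_sq_eq_sq_eq_norm_sub_le hu hv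
    rw [hsq z hz, hsq w hw, ← smul_sub, add_sub_add_comm, norm_smul]
    have h1 := ih z w hz hw
    have h2 := ih (-z) (-w) (by simpa) (by simpa)
    have h3 : ‖-z - -w‖ = ‖z - w‖ := by rw [neg_sub_neg, norm_sub_rev]
    rw [h3] at h2
    have h4 : ‖(2⁻¹ : ℂ)‖ = 2⁻¹ := by simp
    rw [h4]
    calc _ ≤ 2⁻¹ * (L * (3 / 4) ^ k * ‖z - w‖ + L * (3 / 4) ^ k * ‖z - w‖) := by
          gcongr
          exact (norm_add_le _ _).trans (add_le_add h1 h2)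
      _ = L * (3 / 4) ^ k * ‖z - w‖ := by ring
      _ ≤ L * (3 / 4) ^ k * (3 / 4 * ‖z ^ 2 - w ^ 2‖) := by gcongr
      _ = _ := by ring

/-- If the spectrum of `a` does not meet the unit circle, the sequence `(1 - a ^ 2 ^ k)⁻¹`
converges to an idempotent `p`, the Riesz projection of `a` for the open unit disc. -/
theorem exists_tendsto_inverse_one_sub_pow [CompleteSpace A]
    (h : ∀ z ∈ spectrum ℂ a, ‖z‖ ≠ 1) :
    ∃ p : A, IsIdempotentElem p ∧
      Tendsto (fun k : ℕ => Ring.inverse (1 - a ^ 2 ^ k)) atTop (𝓝 p) := by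
  obtain ⟨L, hL⟩ := exists_lipschitz_inverse_one_sub_smul h
  have hdiff : ∀ k : ℕ, ‖Ring.inverse (1 - a ^ 2 ^ k) - Ring.inverse (1 + a ^ 2 ^ k)‖ ≤
      L * 2 * (3 / 4) ^ k := fun k => by
    have := norm_inverse_one_sub_smul_pow_sub_le h hL k 1 (-1) (by simp) (by simp)
    rw [one_smul, neg_one_smul, sub_neg_eq_add] at this
    have h2 : ‖(1 : ℂ) - -1‖ = 2 := by norm_num
    rw [h2] at this
    linarith
  have hu1 : ∀ k : ℕ, IsUnit (1 - a ^ 2 ^ k) := fun k => by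
    simpa using isUnit_one_sub_smul_pow h (n := 2 ^ k) (by positivity) (z := 1) (by simp)
  have hu2 : ∀ k : ℕ, IsUnit (1 + a ^ 2 ^ k) := fun k => by
    simpa using isUnit_one_sub_smul_pow h (n := 2 ^ k) (by positivity) (z := -1) (by simp)
  have hcauchy : CauchySeq fun k : ℕ => Ring.inverse (1 - a ^ 2 ^ k) := by
    refine cauchySeq_of_le_geometric (3 / 4) L (by norm_num) fun k => ?_
    have h1 : Ring.inverse (1 - a ^ 2 ^ k) - Ring.inverse (1 - a ^ 2 ^ (k + 1)) =
        (2⁻¹ : ℂ) • (Ring.inverse (1 - a ^ 2 ^ k) - Ring.inverse (1 + a ^ 2 ^ k)) := by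
      rw [pow_succ, pow_mul, Ring.inverse_one_sub_sq (hu1 k) (hu2 k), smul_add, smul_sub]
      nth_rw 1 [← one_smul ℂ (Ring.inverse (1 - a ^ 2 ^ k))]
      rw [← sub_sub, ← sub_smul]
      norm_num
    rw [dist_eq_norm, h1, norm_smul]
    have h4 : ‖(2⁻¹ : ℂ)‖ = 2⁻¹ := by simp
    rw [h4]
    linarith [hdiff k]
  obtain ⟨p, hp⟩ := cauchySeq_tendsto_of_complete hcauchy
  have hp' : Tendsto (fun k : ℕ => Ring.inverse (1 + a ^ 2 ^ k)) atTop (𝓝 p) := by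
    have h0 : Tendsto (fun k : ℕ => Ring.inverse (1 - a ^ 2 ^ k) - Ring.inverse (1 + a ^ 2 ^ k))
        atTop (𝓝 0) := by
      refine squeeze_zero_norm hdiff ?_
      have := (tendsto_pow_atTop_nhds_zero_of_lt_one (r := (3 / 4 : ℝ)) (by norm_num)
        (by norm_num)).const_mul (L * 2)
      simpa using this
    simpa using hp.sub h0
  refine ⟨p, tendsto_nhds_unique (hp'.mul hp) ?_, hp⟩
  -- Both factors tend to `p`, while `(1 + x) (1 - x) = 1 - x ^ 2` makes the product the next term
  -- of the sequence; hence `p * p = p`.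
  have heq : (fun k : ℕ => Ring.inverse (1 + a ^ 2 ^ k) * Ring.inverse (1 - a ^ 2 ^ k)) =
      fun k : ℕ => Ring.inverse (1 - a ^ 2 ^ (k + 1)) := by
    funext k
    rw [← Ring.inverse_mul (Or.inl (hu1 k)), pow_succ, pow_mul]
    congr 1
    noncomm_ring
  rw [heq]
  exact hp.comp (tendsto_add_atTop_nat 1)

theorem exists_riesz_idempotent [CompleteSpace A] (h : ∀ z ∈ spectrum ℂ a, ‖z‖ ≠ 1) :
    ∃ p : A, IsIdempotentElem p ∧ Commute a p ∧ IsUnit (a * (1 - p) + p) ∧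
      ∀ z ∈ spectrum ℂ (a * p), ‖z‖ < 1 := by
  obtain ⟨p, hpp, hp⟩ := exists_tendsto_inverse_one_sub_pow h
  set F : ℕ → A := fun k => Ring.inverse (1 - a ^ 2 ^ k) with hF
  have hu : ∀ k : ℕ, IsUnit (1 - a ^ 2 ^ k) := fun k => by
    simpa using isUnit_one_sub_smul_pow h (n := 2 ^ k) (by positivity) (z := 1) (by simp)
  have hcomm : ∀ {b : A}, Commute b a → ∀ k, Commute b (F k) := fun {b} hb k => by
    have hb1 : Commute b (1 - a ^ 2 ^ k) := (Commute.one_right b).sub_right (hb.pow_right _)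
    obtain ⟨y, hy⟩ := hu k
    rw [← hy] at hb1
    simpa only [hF, ← hy, Ring.inverse_unit] using hb1.units_inv_right
  have hcommp : ∀ {b : A}, Commute b a → Commute b p := fun {b} hb =>
    tendsto_nhds_unique (hp.const_mul b)
      ((hp.mul_const b).congr fun k => ((hcomm hb k).eq).symm)
  have hap : Commute a p := hcommp (Commute.refl a)
  have hFp : ∀ k, Commute (F k) p := fun k => hcommp (hcomm (Commute.refl a) k).symm
  have haF : ∀ k, a ^ 2 ^ k * F k = F k - 1 := fun k => by
    have : (1 - a ^ 2 ^ k) * F k = 1 := Ring.mul_inverse_cancel _ (hu k)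
    rw [sub_mul, one_mul] at this
    rw [← this]; abel
  have hlim : Tendsto (fun k => a ^ 2 ^ k * F k) atTop (𝓝 (p - 1)) := by
    simp only [haF]
    exact hp.sub_const 1
  refine ⟨p, hpp, hap, ?_, ?_⟩
  -- For large `k` this is a unit, and it factors as `a * (1 - p) + p` times a commuting element, so
  -- both factors are units.
  · have h1 : Tendsto (fun k => a ^ 2 ^ k * F k * (1 - p) - p) atTop (𝓝 (-1)) := by
      have := (hlim.mul_const (1 - p)).sub_const p
      convert this using 2
      calc (-1 : A) = p - p * p - 1 + p - p := by rw [hpp.eq]; abel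
        _ = _ := by noncomm_ring
    obtain ⟨k, hk⟩ := (h1.eventually (Units.isOpen.mem_nhds isUnit_one.neg)).exists
    obtain ⟨m, hm⟩ : ∃ m, 2 ^ k = m + 1 := ⟨2 ^ k - 1, by have := Nat.one_le_two_pow (n := k); omega⟩
    have ha1 : Commute a (1 - p) := (Commute.one_right _).sub_right hap
    have hp1 : Commute p (1 - p) := (Commute.one_right _).sub_right (Commute.refl p)
    have hFa := (hcomm (Commute.refl a) k)
    have hc : Commute (a * (1 - p) + p) (a ^ m * F k * (1 - p) - p) := by
      have c1 : Commute a (a ^ m * F k * (1 - p) - p) :=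
        ((((Commute.refl a).pow_right m).mul_right hFa).mul_right ha1).sub_right hap
      have c2 : Commute p (a ^ m * F k * (1 - p) - p) :=
        (((hap.symm.pow_right m).mul_right (hFp k).symm).mul_right hp1).sub_right (Commute.refl p)
      exact (c1.mul_left ((Commute.one_left _).sub_left c2)).add_left c2
    have hprod : (a * (1 - p) + p) * (a ^ m * F k * (1 - p) - p) =
        a ^ 2 ^ k * F k * (1 - p) - p := by
      have e0 : Commute (1 - p) (a ^ m * F k) :=
        ((ha1.pow_left m).mul_left ((Commute.one_right _).sub_right (hFp k))).symm
      have e1 : p * (a ^ m * F k) = a ^ m * F k * p :=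
        ((hap.symm.pow_right m).mul_right (hFp k).symm).eq
      calc _ = a * ((1 - p) * (a ^ m * F k)) * (1 - p) - a * ((1 - p) * p)
            + (p * (a ^ m * F k)) * (1 - p) - p * p := by noncomm_ring
        _ = a * (a ^ m * F k) * ((1 - p) * (1 - p)) - a * ((1 - p) * p)
            + a ^ m * F k * (p * (1 - p)) - p * p := by rw [e0.eq, e1]; noncomm_ring
        _ = _ := by
          rw [hpp.one_sub.eq, hpp.one_sub_mul_self, hpp.mul_one_sub_self, hpp.eq, hm, pow_succ']
          noncomm_ring
    exact (hc.isUnit_mul_iff.1 (hprod ▸ hk)).1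
  · have h1 : Tendsto (fun k => F k * p + (1 - p)) atTop (𝓝 1) := by
      have := (hp.mul_const p).add_const (1 - p)
      rwa [hpp.eq, add_sub_cancel] at this
    have h2 : Tendsto (fun k => a ^ 2 ^ k * F k * p) atTop (𝓝 0) := by
      have := hlim.mul_const p
      rwa [sub_mul, one_mul, hpp.eq, sub_self] at this
    have h3 : Tendsto (fun k => a ^ 2 ^ k * F k * p * Ring.inverse (F k * p + (1 - p))) atTop
        (𝓝 0) := by
      have hinv : Tendsto (fun k => Ring.inverse (F k * p + (1 - p))) atTop
          (𝓝 (Ring.inverse (1 : A))) :=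
        (NormedRing.inverse_continuousAt (1 : Aˣ)).tendsto.comp h1
      simpa using h2.mul hinv
    -- On the corner of `p`, `F k` tends to the identity and can be divided out.
    have h4 : Tendsto (fun k => a ^ 2 ^ k * p) atTop (𝓝 0) := by
      refine h3.congr' ?_
      filter_upwards [h1.eventually (Units.isOpen.mem_nhds isUnit_one)] with k hk
      have : a ^ 2 ^ k * F k * p = a ^ 2 ^ k * p * (F k * p + (1 - p)) := by
        calc a ^ 2 ^ k * F k * p = a ^ 2 ^ k * (F k * p) := mul_assoc _ _ _
          _ = a ^ 2 ^ k * (F k * (p * p)) := by rw [hpp.eq]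
          _ = a ^ 2 ^ k * (F k * p * p) := by rw [mul_assoc (F k)]
          _ = a ^ 2 ^ k * (p * F k * p + p * (1 - p)) := by
            rw [(hFp k).eq, hpp.mul_one_sub_self, add_zero]
          _ = _ := by noncomm_ring
      rw [this, mul_assoc, Ring.mul_inverse_cancel _ hk, mul_one]
    -- The factor `‖1‖` is needed because the norm of `1` need not be `1`.
    have h5 : Tendsto (fun k => ‖a ^ 2 ^ k * p‖ * ‖(1 : A)‖) atTop (𝓝 0) := by
      simpa using h4.norm.mul_const ‖(1 : A)‖
    obtain ⟨k, hk⟩ := (h5.eventually (gt_mem_nhds zero_lt_one)).exists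
    intro z hz
    have h6 := spectrum.pow_mem_pow (a * p) (2 ^ k) hz
    obtain ⟨m, hm⟩ : ∃ m, 2 ^ k = m + 1 := ⟨2 ^ k - 1, by have := Nat.one_le_two_pow (n := k); omega⟩
    have h7 : p ^ 2 ^ k = p := by rw [hm, hpp.pow_succ_eq]
    rw [hap.mul_pow, h7] at h6
    have h8 := spectrum.norm_le_norm_mul_of_mem h6
    rw [norm_pow] at h8
    exact lt_of_not_ge fun hge => absurd (one_le_pow₀ hge (n := 2 ^ k)) (by linarith)

end RieszProjection

/-! ### Invertibility passes to direct summands. -/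

section Summand

variable {X Y : Type*} [NormedAddCommGroup X] [NormedSpace ℂ X] [NormedAddCommGroup Y]
  [NormedSpace ℂ Y] {u : X →L[ℂ] X} {v : Y →L[ℂ] Y} {i : Y →L[ℂ] X} {p : X →L[ℂ] Y}

theorem ContinuousLinearMap.pow_apply_of_intertwines (hpu : ∀ x, p (u x) = v (p x)) (n : ℕ)
    (x : X) : p ((u ^ n) x) = (v ^ n) (p x) := by
  induction n with
  | zero => rfl
  | succ n ih => rw [pow_succ', pow_succ', mul_apply_eq_comp, hpu, ih]; rfl

theorem IsUnit.of_summand (hpi : ∀ y, p (i y) = y) (hui : ∀ y, u (i y) = i (v y))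
    (hpu : ∀ x, p (u x) = v (p x)) (hu : IsUnit u) : IsUnit v := by
  obtain ⟨w, rfl⟩ := hu
  have h1 : ∀ x, (w : X →L[ℂ] X) ((↑w⁻¹ : X →L[ℂ] X) x) = x := fun x => by
    rw [← mul_apply_eq_comp, Units.mul_inv]; rfl
  have h2 : ∀ x, (↑w⁻¹ : X →L[ℂ] X) ((w : X →L[ℂ] X) x) = x := fun x => by
    rw [← mul_apply_eq_comp, Units.inv_mul]; rfl
  refine ⟨⟨v, p ∘L (↑w⁻¹ : X →L[ℂ] X) ∘L i, ?_, ?_⟩, rfl⟩ <;> ext y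
  · simp only [mul_apply_eq_comp, ContinuousLinearMap.comp_apply, ← hpu, h1, hpi,
      one_apply_eq_self]
  · simp only [mul_apply_eq_comp, ContinuousLinearMap.comp_apply, ← hui, h2, hpi,
      one_apply_eq_self]

theorem IsDrazinInvertible.of_summand (hpi : ∀ y, p (i y) = y) (hui : ∀ y, u (i y) = i (v y))
    (hpu : ∀ x, p (u x) = v (p x)) (hu : IsDrazinInvertible u) : IsDrazinInvertible v := by
  obtain ⟨s, hsu, hs, k, hk⟩ := hu
  -- The projection `i ∘L p` commutes with `u`, hence with its Drazin inverse `s`, so the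
  -- compression of `s` is a Drazin inverse of `v`.
  have hip : Commute (i ∘L p) u := by
    ext x
    simp only [mul_apply_eq_comp, ContinuousLinearMap.comp_apply, hpu, hui]
  have hips : ∀ x, i (p (s x)) = s (i (p x)) := fun x =>
    DFunLike.congr_fun (Commute.drazin_inverse hsu hs hk hip).eq x
  have hsu' : ∀ x, s (u x) = u (s x) := fun x => DFunLike.congr_fun hsu.eq x
  have hs' : ∀ x, s (u (s x)) = s x := fun x => DFunLike.congr_fun hs x
  have hk' : ∀ x, (u ^ (k + 1)) (s x) = (u ^ k) x := fun x => DFunLike.congr_fun hk x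
  refine ⟨p ∘L s ∘L i, ?_, ?_, k, ?_⟩ <;> ext y
  · simp only [mul_apply_eq_comp, ContinuousLinearMap.comp_apply, ← hui, ← hpu, hsu']
  · simp only [mul_apply_eq_comp, ContinuousLinearMap.comp_apply, ← hui, hips, hs',
      hpi]
  · simp only [mul_apply_eq_comp, ContinuousLinearMap.comp_apply,
      ← ContinuousLinearMap.pow_apply_of_intertwines hpu, hk']
    rw [ContinuousLinearMap.pow_apply_of_intertwines hpu, hpi]

-- In this form Fredholmness transfers algebraically, since finite-rank maps remain so under
-- composition on either side.
open LinearMap.FiniteRangeSetoid in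
theorem isFredholm_iff_exists_hasFiniteRange :
    u.IsFredholm ↔ ∃ w : X →L[ℂ] X, (w * u - 1 : X →L[ℂ] X).toLinearMap.HasFiniteRange ∧
      (u * w - 1 : X →L[ℂ] X).toLinearMap.HasFiniteRange := by
  rw [ContinuousLinearMap.isFredholm_iff_exists_isQuasiInverse]
  refine exists_congr fun w => and_congr ?_ ?_ <;>
  exact equiv_iff_hasFiniteRange

theorem ContinuousLinearMap.IsFredholm.of_summand (hpi : ∀ y, p (i y) = y)
    (hui : ∀ y, u (i y) = i (v y)) (hpu : ∀ x, p (u x) = v (p x)) (hu : u.IsFredholm) :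
    v.IsFredholm := by
  rw [isFredholm_iff_exists_hasFiniteRange] at hu ⊢
  obtain ⟨w, h1, h2⟩ := hu
  refine ⟨p ∘L w ∘L i, ?_, ?_⟩
  · have heq : ((p ∘L w ∘L i) * v - 1 : Y →L[ℂ] Y).toLinearMap =
        (p.toLinearMap ∘ₗ (w * u - 1 : X →L[ℂ] X).toLinearMap) ∘ₗ i.toLinearMap := by
      ext y
      simp [hui, hpi]
    rw [heq]
    exact (h1.comp_left p.toLinearMap).comp_right i.toLinearMap
  · have heq : (v * (p ∘L w ∘L i) - 1 : Y →L[ℂ] Y).toLinearMap =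
        (p.toLinearMap ∘ₗ (u * w - 1 : X →L[ℂ] X).toLinearMap) ∘ₗ i.toLinearMap := by
      ext y
      simp [hpu, hpi]
    rw [heq]
    exact (h2.comp_left p.toLinearMap).comp_right i.toLinearMap

end Summand

/-! ### Direct sums of operators. -/

section BlockDiagonal

variable {X : Type*} [NormedAddCommGroup X] [NormedSpace ℂ X] {M N : Submodule ℂ X}
  (h : Submodule.IsTopCompl M N)

/-- The direct sum of two operators along a topological direct sum decomposition. -/
noncomputable def Submodule.IsTopCompl.blockDiag (A : M →L[ℂ] M) (B : N →L[ℂ] N) : X →L[ℂ] X :=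
  M.subtypeL ∘L A ∘L M.projectionOntoL N h + N.subtypeL ∘L B ∘L N.projectionOntoL M h.symm

theorem Submodule.IsTopCompl.blockDiag_apply (A : M →L[ℂ] M) (B : N →L[ℂ] N) (x : X) :
    h.blockDiag A B x = A (M.projectionOntoL N h x) + B (N.projectionOntoL M h.symm x) := rfl

theorem Submodule.IsTopCompl.blockDiag_mul (A A' : M →L[ℂ] M) (B B' : N →L[ℂ] N) :
    h.blockDiag A B * h.blockDiag A' B' = h.blockDiag (A * A') (B * B') := by
  ext x
  simp [blockDiag_apply]

theorem Submodule.IsTopCompl.add_projectionOntoL (x : X) :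
    (M.projectionOntoL N h x : X) + N.projectionOntoL M h.symm x = x := by
  simpa using Submodule.projection_add_projection_eq_self h.isCompl x

theorem Submodule.IsTopCompl.blockDiag_one : h.blockDiag 1 1 = 1 := by
  ext x
  exact h.add_projectionOntoL x

theorem Submodule.IsTopCompl.blockDiag_pow (A : M →L[ℂ] M) (B : N →L[ℂ] N) (n : ℕ) :
    h.blockDiag A B ^ n = h.blockDiag (A ^ n) (B ^ n) := by
  induction n with
  | zero => simp [blockDiag_one]
  | succ n ih => rw [pow_succ, ih, blockDiag_mul, pow_succ, pow_succ]

theorem Submodule.IsTopCompl.blockDiag_restrict (T : X →L[ℂ] X) (hM : ∀ x ∈ M, T x ∈ M)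
    (hN : ∀ x ∈ N, T x ∈ N) : h.blockDiag (T.restrict hM) (T.restrict hN) = T := by
  ext x
  conv_rhs => rw [← h.add_projectionOntoL x, map_add]
  rfl

theorem Submodule.IsTopCompl.isUnit_blockDiag {A : M →L[ℂ] M} {B : N →L[ℂ] N} (hA : IsUnit A)
    (hB : IsUnit B) : IsUnit (h.blockDiag A B) := by
  obtain ⟨a, rfl⟩ := hA
  obtain ⟨b, rfl⟩ := hB
  refine ⟨⟨h.blockDiag a b, h.blockDiag ↑a⁻¹ ↑b⁻¹, ?_, ?_⟩, rfl⟩ <;> simp [blockDiag_mul, blockDiag_one]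

theorem Submodule.IsTopCompl.isDrazinInvertible_blockDiag {A : M →L[ℂ] M} {B : N →L[ℂ] N}
    (hA : IsUnit A) (hB : IsDrazinInvertible B) : IsDrazinInvertible (h.blockDiag A B) := by
  obtain ⟨a, rfl⟩ := hA
  obtain ⟨s, hsB, hs, k, hk⟩ := hB
  refine ⟨h.blockDiag ↑a⁻¹ s, ?_, ?_, k, ?_⟩
  · rw [Commute, SemiconjBy, blockDiag_mul, blockDiag_mul, hsB.eq, Units.inv_mul, Units.mul_inv]
  · rw [blockDiag_mul, blockDiag_mul, hs, Units.inv_mul, one_mul]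
  · rw [blockDiag_pow, blockDiag_mul, blockDiag_pow, hk, pow_succ, Units.mul_inv_cancel_right]

theorem Submodule.IsTopCompl.isFredholm_blockDiag {A : M →L[ℂ] M} {B : N →L[ℂ] N}
    (hA : IsUnit A) (hB : B.IsFredholm) : (h.blockDiag A B).IsFredholm := by
  obtain ⟨a, rfl⟩ := hA
  rw [isFredholm_iff_exists_hasFiniteRange] at hB ⊢
  obtain ⟨w, h1, h2⟩ := hB
  have key : ∀ C : N →L[ℂ] N, (C - 1 : N →L[ℂ] N).toLinearMap.HasFiniteRange →
      (h.blockDiag 1 C - 1 : X →L[ℂ] X).toLinearMap.HasFiniteRange := fun C hC => by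
    have heq : (h.blockDiag 1 C - 1 : X →L[ℂ] X).toLinearMap =
        (N.subtype ∘ₗ (C - 1 : N →L[ℂ] N).toLinearMap) ∘ₗ
          (N.projectionOntoL M h.symm).toLinearMap := by
      ext x
      show (M.projectionOntoL N h x : X) + C (N.projectionOntoL M h.symm x) - x =
        C (N.projectionOntoL M h.symm x) - N.projectionOntoL M h.symm x
      nth_rw 3 [← h.add_projectionOntoL x]
      abel
    rw [heq]
    exact (hC.comp_left N.subtype).comp_right (N.projectionOntoL M h.symm).toLinearMap
  refine ⟨h.blockDiag ↑a⁻¹ w, ?_, ?_⟩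
  · rw [blockDiag_mul, Units.inv_mul]; exact key _ h1
  · rw [blockDiag_mul, Units.mul_inv]; exact key _ h2

variable {h} in
theorem Submodule.IsTopCompl.projectionOntoL_comm {T : X →L[ℂ] X} (hM : ∀ x ∈ M, T x ∈ M)
    (hN : ∀ x ∈ N, T x ∈ N) (x : X) : N.projectionOntoL M h.symm (T x) =
      T.restrict hN (N.projectionOntoL M h.symm x) := by
  conv_lhs => rw [← h.add_projectionOntoL x, map_add, map_add]
  rw [Submodule.projectionOntoL_apply_eq_zero_of_mem_right _ (hM _ (SetLike.coe_mem _)), zero_add]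
  exact Submodule.projectionOntoL_apply_left h.symm (T.restrict hN _)

end BlockDiagonal

/-! ### Browder means Fredholm and Drazin invertible. -/

section Browder

variable {X : Type*} [NormedAddCommGroup X] [NormedSpace ℂ X] {T : X →L[ℂ] X}

theorem ContinuousLinearMap.IsFredholm.pow (hT : T.IsFredholm) (n : ℕ) : (T ^ n).IsFredholm := by
  induction n with
  | zero =>
    rw [isFredholm_iff_exists_hasFiniteRange]
    exact ⟨1, by simp, by simp⟩
  | succ n ih =>
    obtain ⟨v, hv⟩ := ih.exists_isQuasiInverse
    obtain ⟨w, hw⟩ := hT.exists_isQuasiInverse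
    rw [pow_succ']
    exact .of_isQuasiInverse (v := v ∘L w) (hv.comp hw)

theorem IsDrazinInvertible.hasFiniteAscent (hT : IsDrazinInvertible T) : HasFiniteAscent T := by
  obtain ⟨s, hsT, -, k, hk⟩ := hT
  refine ⟨k, le_antisymm (fun x hx => ?_) fun x hx => ?_⟩
  · simp only [LinearMap.mem_ker, ContinuousLinearMap.coe_coe] at hx ⊢
    rw [pow_succ', mul_apply_eq_comp, hx, map_zero]
  · simp only [LinearMap.mem_ker, ContinuousLinearMap.coe_coe] at hx ⊢
    rw [← hk, ← (hsT.pow_right _).eq, mul_apply_eq_comp, hx, map_zero]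

theorem IsDrazinInvertible.hasFiniteDescent (hT : IsDrazinInvertible T) : HasFiniteDescent T := by
  obtain ⟨s, -, -, k, hk⟩ := hT
  refine ⟨k, le_antisymm ?_ ?_⟩
  · rintro _ ⟨x, rfl⟩
    exact ⟨s x, DFunLike.congr_fun hk x⟩
  · rintro _ ⟨x, rfl⟩
    exact ⟨T x, by rw [pow_succ]; rfl⟩

theorem HasFiniteAscent.exists_forall_pow (hT : HasFiniteAscent T) :
    ∃ p, ∀ m ≥ p, ∀ x, (T ^ m) x = 0 → (T ^ p) x = 0 := by
  obtain ⟨p, hp⟩ := hT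
  refine ⟨p, fun m hm => ?_⟩
  induction m, hm using Nat.le_induction with
  | base => exact fun _ => id
  | succ m hm ih =>
    intro x hx
    refine ih x ?_
    obtain ⟨d, rfl⟩ := Nat.exists_eq_add_of_le hm
    have h1 : (T ^ d) x ∈ (T ^ (p + 1)).ker := by
      rw [LinearMap.mem_ker, ContinuousLinearMap.coe_coe, ← mul_apply_eq_comp,
        ← pow_add, add_right_comm, hx]
    rw [← hp, LinearMap.mem_ker, ContinuousLinearMap.coe_coe, ← mul_apply_eq_comp,
      ← pow_add] at h1
    exact h1

theorem HasFiniteDescent.exists_forall_pow (hT : HasFiniteDescent T) :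
    ∃ q, ∀ m ≥ q, ∀ x, ∃ y, (T ^ m) y = (T ^ q) x := by
  obtain ⟨q, hq⟩ := hT
  refine ⟨q, fun m hm => ?_⟩
  induction m, hm using Nat.le_induction with
  | base => exact fun x => ⟨x, rfl⟩
  | succ m hm ih =>
    intro x
    obtain ⟨y, hy⟩ := ih x
    obtain ⟨d, rfl⟩ := Nat.exists_eq_add_of_le' hm
    have h1 : (T ^ q) y ∈ (T ^ (q + 1)).range := hq ▸ ⟨y, rfl⟩
    obtain ⟨z, hz⟩ := h1
    refine ⟨z, ?_⟩
    rw [← hy, add_assoc, pow_add, pow_add _ d q, mul_apply_eq_comp, mul_apply_eq_comp]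
    exact congrArg (T ^ d) hz

theorem IsBrowder.isDrazinInvertible [CompleteSpace X] (hT : IsBrowder T) :
    IsDrazinInvertible T := by
  obtain ⟨hF, hA, hD⟩ := hT
  obtain ⟨p, hp⟩ := hA.exists_forall_pow
  obtain ⟨q, hq⟩ := hD.exists_forall_pow
  have hker : ∀ n ≥ p, ∀ m ≥ p, ∀ x, (T ^ m) x = 0 → (T ^ n) x = 0 := fun n hn m hm x hx => by
    obtain ⟨d, rfl⟩ := Nat.exists_eq_add_of_le' hn
    rw [pow_add, mul_apply_eq_comp, hp m hm x hx, map_zero]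
  have hrange : ∀ n ≥ q, ∀ m ≥ q, ∀ x, ∃ y, (T ^ m) y = (T ^ n) x := fun n hn m hm x => by
    obtain ⟨d, rfl⟩ := Nat.exists_eq_add_of_le hn
    rw [pow_add, mul_apply_eq_comp]
    exact hq m hm _
  set n := max p q
  have hnp : p ≤ n := le_max_left _ _
  have hnq : q ≤ n := le_max_right _ _
  -- Finite ascent makes the intersection trivial; finite descent makes the sum all of `X`.
  have hcompl : IsCompl (T ^ n).range (T ^ n).ker := by
    refine ⟨Submodule.disjoint_def.2 ?_, codisjoint_iff.2 (eq_top_iff.2 fun x _ => ?_)⟩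
    · rintro _ ⟨x, rfl⟩ hx
      refine hker n hnp (n + n) (by omega) x ?_
      rw [pow_add]
      exact hx
    · obtain ⟨y, hy⟩ := hrange n hnq (n + n) (by omega) x
      rw [pow_add, mul_apply_eq_comp] at hy
      refine Submodule.mem_sup.2 ⟨(T ^ n) y, ⟨y, rfl⟩, x - (T ^ n) y, ?_, by abel⟩
      rw [LinearMap.mem_ker, map_sub, sub_eq_zero]
      exact hy.symm
  have hclosed : IsClosed ((T ^ n).range : Set X) := (hF.pow n).isClosed_range
  have htop : Submodule.IsTopCompl (T ^ n).range (T ^ n).ker :=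
    Submodule.isTopCompl_iff_isCompl_isClosed.2 ⟨hcompl, hclosed, (T ^ n).isClosed_ker⟩
  have hTn : ∀ x, (T ^ n) (T x) = T ((T ^ n) x) := fun x =>
    DFunLike.congr_fun ((Commute.refl T).pow_left n).eq x
  have hM : ∀ x ∈ (T ^ n).range, T x ∈ (T ^ n).range := by
    rintro _ ⟨x, rfl⟩
    exact ⟨T x, hTn x⟩
  have hN : ∀ x ∈ (T ^ n).ker, T x ∈ (T ^ n).ker := fun x hx => by
    have hx' : (T ^ n) x = 0 := hx
    show (T ^ n) (T x) = 0
    rw [hTn, hx', map_zero]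
  rw [← htop.blockDiag_restrict T hM hN]
  have := hclosed.completeSpace_coe
  -- `T` is bijective on the range of `T ^ n` and nilpotent on its kernel, where the Drazin inverse
  -- is `0`.
  refine htop.isDrazinInvertible_blockDiag ?_ ⟨0, Commute.zero_left _, by simp, n, ?_⟩
  · rw [ContinuousLinearMap.isUnit_iff_bijective]
    constructor
    · rw [injective_iff_map_eq_zero]
      rintro ⟨_, x, rfl⟩ hx
      refine Subtype.ext (hker n hnp (n + 1) (by omega) x ?_)
      rw [pow_succ']
      exact congrArg Subtype.val hx
    · rintro ⟨_, x, rfl⟩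
      obtain ⟨y, hy⟩ := hrange n hnq (n + 1) (by omega) x
      refine ⟨⟨_, y, rfl⟩, Subtype.ext ?_⟩
      rw [pow_succ'] at hy
      exact hy
  · ext x
    rw [mul_zero]
    have := ContinuousLinearMap.pow_apply_of_intertwines (u := T.restrict hN) (v := T)
      (p := (T ^ n).ker.subtypeL) (fun _ => rfl) n x
    exact (this.trans x.2).symm

theorem isBrowder_iff [CompleteSpace X] : IsBrowder T ↔ T.IsFredholm ∧ IsDrazinInvertible T :=
  ⟨fun h => ⟨h.1, h.isDrazinInvertible⟩,
    fun h => ⟨h.1, h.2.hasFiniteAscent, h.2.hasFiniteDescent⟩⟩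

end Browder

/-! ### The three spectra and their behaviour under decompositions. -/

section Spec

variable {X : Type*} [NormedAddCommGroup X] [NormedSpace ℂ X] {κ : SpectrumKind} {T : X →L[ℂ] X}
  {z : ℂ}

/-- The kind of invertibility that defines the spectrum `σ_*`. -/
def SpectrumKind.IsInvertible : SpectrumKind → (X →L[ℂ] X) → Prop
  | .ordinary, T => IsUnit T
  | .browder, T => IsBrowder T
  | .drazin, T => IsDrazinInvertible T

theorem notMem_spectrum_iff_isUnit_sub_smul_one :
    z ∉ spectrum ℂ T ↔ IsUnit (T - z • (1 : X →L[ℂ] X)) := by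
  rw [spectrum.notMem_iff, Algebra.algebraMap_eq_smul_one, ← IsUnit.neg_iff, neg_sub]

theorem SpectrumKind.notMem_spec :
    z ∉ κ.spec T ↔ κ.IsInvertible (T - z • (1 : X →L[ℂ] X)) := by
  cases κ with
  | ordinary => exact notMem_spectrum_iff_isUnit_sub_smul_one
  | browder => exact not_not
  | drazin => exact not_not

theorem SpectrumKind.spec_sub_smul_one (κ : SpectrumKind) (T : X →L[ℂ] X) (μ : ℂ) :
    κ.spec (T - μ • (1 : X →L[ℂ] X)) = Homeomorph.addRight μ ⁻¹' κ.spec T := by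
  ext z
  rw [← not_iff_not, mem_preimage, notMem_spec, notMem_spec, Homeomorph.coe_addRight, sub_sub,
    ← add_smul, add_comm]

theorem SpectrumKind.zero_mem_spec_sub_smul_one {μ : ℂ} :
    0 ∈ κ.spec (T - μ • (1 : X →L[ℂ] X)) ↔ μ ∈ κ.spec T := by
  rw [spec_sub_smul_one, mem_preimage, Homeomorph.coe_addRight]
  simp only [zero_add]

theorem IsUnit.isDrazinInvertible (h : IsUnit T) : IsDrazinInvertible T := by
  obtain ⟨u, rfl⟩ := h
  exact ⟨↑u⁻¹, by rw [Commute, SemiconjBy, Units.inv_mul, Units.mul_inv], by simp, 0, by simp⟩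

theorem IsUnit.isFredholm (h : IsUnit T) : T.IsFredholm := by
  obtain ⟨u, rfl⟩ := h
  rw [isFredholm_iff_exists_hasFiniteRange]
  exact ⟨↑u⁻¹, by simp, by simp⟩

theorem SpectrumKind.IsInvertible.of_isUnit (h : IsUnit T) : κ.IsInvertible T := by
  cases κ with
  | ordinary => exact h
  | browder =>
    have hd := h.isDrazinInvertible
    exact ⟨h.isFredholm, hd.hasFiniteAscent, hd.hasFiniteDescent⟩
  | drazin => exact h.isDrazinInvertible

theorem SpectrumKind.spec_subset_spectrum (κ : SpectrumKind) (T : X →L[ℂ] X) :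
    κ.spec T ⊆ spectrum ℂ T := fun z hz => by
  by_contra h
  exact notMem_spec.2 (.of_isUnit (notMem_spectrum_iff_isUnit_sub_smul_one.1 h)) hz

variable [CompleteSpace X]

theorem SpectrumKind.IsInvertible.eventually_isUnit (h : κ.IsInvertible T) :
    ∀ᶠ z : ℂ in 𝓝[≠] 0, IsUnit (T - z • (1 : X →L[ℂ] X)) := by
  have hd : IsDrazinInvertible T := by
    cases κ with
    | ordinary => exact IsUnit.isDrazinInvertible h
    | browder => exact IsBrowder.isDrazinInvertible h
    | drazin => exact h
  obtain ⟨s, hsT, hs, k, hk⟩ := hd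
  exact eventually_isUnit_sub_of_drazin hsT hs hk

/-- This isolation property yields both the closedness of `σ_*(T)` and the countability argument. -/
theorem SpectrumKind.eventually_notMem_spectrum (h : z ∉ κ.spec T) :
    ∀ᶠ w in 𝓝[≠] z, w ∉ spectrum ℂ T := by
  have h1 := (notMem_spec.1 h).eventually_isUnit
  have h2 : Tendsto (fun w => w - z) (𝓝[≠] z) (𝓝[≠] 0) := by
    refine tendsto_nhdsWithin_iff.2 ⟨?_, ?_⟩
    · exact (Continuous.tendsto' (f := fun w : ℂ => w - z) (by fun_prop) z 0 (sub_self z)).mono_left nhdsWithin_le_nhds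
    · filter_upwards [self_mem_nhdsWithin] with w hw
      exact sub_ne_zero.2 hw
  filter_upwards [h2.eventually h1] with w hw
  rw [notMem_spectrum_iff_isUnit_sub_smul_one]
  convert hw using 1
  rw [sub_sub, ← add_smul, add_sub_cancel]

theorem SpectrumKind.isClosed_spec (κ : SpectrumKind) (T : X →L[ℂ] X) :
    IsClosed (κ.spec T) := by
  rw [← isOpen_compl_iff, isOpen_iff_mem_nhds]
  intro z hz
  have h := eventually_nhdsWithin_iff.1 (eventually_notMem_spectrum hz)
  filter_upwards [h] with w hw
  by_cases hwz : w = z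
  · rwa [hwz]
  · exact fun hw' => hw hwz (κ.spec_subset_spectrum T hw')

variable {M N : Submodule ℂ X}

theorem SpectrumKind.IsInvertible.restrict (h : Submodule.IsTopCompl M N)
    (hM : ∀ x ∈ M, T x ∈ M) (hN : ∀ x ∈ N, T x ∈ N) (hT : κ.IsInvertible T) :
    κ.IsInvertible (T.restrict hN : N →L[ℂ] N) := by
  have := h.isClosed'.completeSpace_coe
  have h1 : ∀ y : N, N.projectionOntoL M h.symm (N.subtypeL y) = y :=
    fun y => Submodule.projectionOntoL_apply_left h.symm y
  have h2 : ∀ y, T (N.subtypeL y) = N.subtypeL (T.restrict hN y) := fun _ => rfl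
  have h3 := Submodule.IsTopCompl.projectionOntoL_comm (h := h) hM hN
  cases κ with
  | ordinary => exact IsUnit.of_summand h1 h2 h3 hT
  | browder =>
    obtain ⟨hF, hD⟩ := isBrowder_iff.1 hT
    exact isBrowder_iff.2 ⟨hF.of_summand h1 h2 h3, hD.of_summand h1 h2 h3⟩
  | drazin => exact IsDrazinInvertible.of_summand h1 h2 h3 hT

theorem SpectrumKind.IsInvertible.of_restrict (h : Submodule.IsTopCompl M N)
    (hM : ∀ x ∈ M, T x ∈ M) (hN : ∀ x ∈ N, T x ∈ N) (hTM : IsUnit (T.restrict hM : M →L[ℂ] M))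
    (hTN : κ.IsInvertible (T.restrict hN : N →L[ℂ] N)) : κ.IsInvertible T := by
  have := h.isClosed'.completeSpace_coe
  rw [← h.blockDiag_restrict T hM hN]
  cases κ with
  | ordinary => exact h.isUnit_blockDiag hTM hTN
  | browder =>
    obtain ⟨hF, hD⟩ := isBrowder_iff.1 hTN
    exact isBrowder_iff.2 ⟨h.isFredholm_blockDiag hTM hF, h.isDrazinInvertible_blockDiag hTM hD⟩
  | drazin => exact h.isDrazinInvertible_blockDiag hTM hTN

omit [CompleteSpace X] in
theorem Submodule.sub_smul_one_mem (hN : ∀ x ∈ N, T x ∈ N) (z : ℂ) :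
    ∀ x ∈ N, (T - z • (1 : X →L[ℂ] X)) x ∈ N := fun x hx =>
  N.sub_mem (hN x hx) (N.smul_mem z hx)

theorem SpectrumKind.spec_restrict_subset (κ : SpectrumKind) (h : Submodule.IsTopCompl M N)
    (hM : ∀ x ∈ M, T x ∈ M) (hN : ∀ x ∈ N, T x ∈ N) :
    κ.spec (T.restrict hN : N →L[ℂ] N) ⊆ κ.spec T := fun z hz => by
  by_contra hzT
  exact notMem_spec.2 ((notMem_spec.1 hzT).restrict h (Submodule.sub_smul_one_mem hM z)
    (Submodule.sub_smul_one_mem hN z)) hz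

theorem SpectrumKind.spec_inter_subset (κ : SpectrumKind) (h : Submodule.IsTopCompl M N)
    (hM : ∀ x ∈ M, T x ∈ M) (hN : ∀ x ∈ N, T x ∈ N) :
    κ.spec T ∩ (spectrum ℂ (T.restrict hM : M →L[ℂ] M))ᶜ ⊆
      κ.spec (T.restrict hN : N →L[ℂ] N) := fun z hz => by
  by_contra hzN
  exact notMem_spec.2 (.of_restrict h (Submodule.sub_smul_one_mem hM z)
    (Submodule.sub_smul_one_mem hN z) (notMem_spectrum_iff_isUnit_sub_smul_one.1 hz.2)
    (notMem_spec.1 hzN)) hz.1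

end Spec

theorem isUnit_of_isUnit_units_smul {R : Type*} [Ring R] [Algebra ℂ R] {c : ℂˣ} {a : R}
    (h : IsUnit (c • a)) : IsUnit a := by
  simpa only [inv_smul_smul] using h.smul c⁻¹

/-! ### Decompositions and derivatives of the spectrum at `0`. -/

section Decomposition

variable {X : Type*} [NormedAddCommGroup X] [NormedSpace ℂ X] [CompleteSpace X]
  {κ : SpectrumKind} {T : X →L[ℂ] X}

/-- If the spectrum of `T` does not meet the circle of radius `r`, then `T` is the direct sum of an
invertible operator and an operator whose spectrum lies in the disc of radius `r`. -/
theorem exists_isTopCompl_of_spectrum_disjoint_sphere {r : ℝ} (hr : 0 < r)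
    (hT : ∀ z ∈ spectrum ℂ T, ‖z‖ ≠ r) :
    ∃ (M N : Submodule ℂ X) (hM : ∀ x ∈ M, T x ∈ M) (hN : ∀ x ∈ N, T x ∈ N),
      Submodule.IsTopCompl M N ∧ IsUnit (T.restrict hM : M →L[ℂ] M) ∧
      ∀ z ∈ spectrum ℂ (T.restrict hN : N →L[ℂ] N), ‖z‖ < r := by
  have hr0 : (r : ℂ)⁻¹ ≠ 0 := by simpa using hr.ne'
  -- Rescaling turns the circle of radius `r` into the unit circle.
  set c : ℂˣ := Units.mk0 (r : ℂ)⁻¹ hr0 with hc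
  have hcn : ∀ z : ℂ, ‖c • z‖ = r⁻¹ * ‖z‖ := fun z => by
    rw [Units.smul_def, norm_smul, hc, Units.val_mk0, norm_inv, Complex.norm_real,
      Real.norm_of_nonneg hr.le]
  have h1 : ∀ z ∈ spectrum ℂ (c • T), ‖z‖ ≠ 1 := by
    rw [spectrum.unit_smul_eq_smul]
    rintro _ ⟨z, hz, rfl⟩ h
    refine hT z hz ?_
    have h' : ‖c • z‖ = 1 := h
    rw [hcn] at h'
    field_simp at h'
    exact h'
  obtain ⟨p, hp, hcomm, hu, hsp⟩ := exists_riesz_idempotent h1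
  have hpp : ∀ x, p (p x) = p x := fun x => DFunLike.congr_fun hp.eq x
  have hpT : ∀ x, p (T x) = T (p x) := fun x => by
    have h2 : c • T (p x) = p (c • T x) := DFunLike.congr_fun hcomm.eq x
    rw [Units.smul_def, Units.smul_def, map_smul] at h2
    exact (smul_right_injective X c.ne_zero h2).symm
  have hM : ∀ x ∈ p.ker, T x ∈ p.ker := fun x hx => by
    have hx' : p x = 0 := hx
    show p (T x) = 0
    rw [hpT, hx', map_zero]
  have hN : ∀ x ∈ p.range, T x ∈ p.range := by
    rintro _ ⟨x, rfl⟩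
    exact ⟨T x, hpT x⟩
  have hpN : ∀ x ∈ p.range, p x = x := by
    rintro _ ⟨x, rfl⟩
    exact hpp x
  have htop : Submodule.IsTopCompl p.ker p.range :=
    (ContinuousLinearMap.IsIdempotentElem.isTopCompl hp).symm
  refine ⟨p.ker, p.range, hM, hN, htop, ?_, ?_⟩
  · have hM' : ∀ x ∈ p.ker, ((c • T) * (1 - p) + p) x ∈ p.ker := fun x hx => by
      have hx' : p x = 0 := hx
      have : ((c • T) * (1 - p) + p) x = c • T x := by simp [hx']
      rw [this]
      exact Submodule.smul_mem _ (c : ℂ) (hM x hx)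
    have hN' : ∀ x ∈ p.range, ((c • T) * (1 - p) + p) x ∈ p.range := fun x hx => by
      have : ((c • T) * (1 - p) + p) x = x := by simp [hpN x hx]
      rwa [this]
    have h3 : IsUnit (((c • T) * (1 - p) + p).restrict hM' : p.ker →L[ℂ] p.ker) :=
      SpectrumKind.IsInvertible.restrict (κ := .ordinary) htop.symm hN' hM' hu
    have h4 : ((c • T) * (1 - p) + p).restrict hM' = c • T.restrict hM := by
      ext x
      have hx' : p x = 0 := x.2
      show ((c • T) * (1 - p) + p) x = c • T x
      simp [hx']
    rw [h4] at h3
    exact isUnit_of_isUnit_units_smul h3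
  · intro z hz
    have hM' : ∀ x ∈ p.ker, ((c • T) * p) x ∈ p.ker := fun x hx => by
      have hx' : p x = 0 := hx
      have : ((c • T) * p) x = 0 := by simp [hx']
      rw [this]
      exact Submodule.zero_mem _
    have hN' : ∀ x ∈ p.range, ((c • T) * p) x ∈ p.range := fun x hx => by
      have : ((c • T) * p) x = c • T x := by simp [hpN x hx]
      rw [this]
      exact Submodule.smul_mem _ (c : ℂ) (hN x hx)
    have h3 := SpectrumKind.spec_restrict_subset .ordinary htop hM' hN'
    have h4 : ((c • T) * p).restrict hN' = c • T.restrict hN := by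
      ext x
      show ((c • T) * p) x = c • T x
      simp [hpN x x.2]
    rw [h4] at h3
    have h5 : c • z ∈ spectrum ℂ (c • T.restrict hN : p.range →L[ℂ] p.range) := by
      rw [spectrum.unit_smul_eq_smul]
      exact smul_mem_smul_set hz
    have h6 := hsp _ (h3 h5)
    rw [hcn, inv_mul_lt_iff₀ hr, mul_one] at h6
    exact h6

theorem Submodule.IsTopCompl.zero_notMem_accIter {M N : Submodule ℂ X}
    (h : Submodule.IsTopCompl M N) (hM : ∀ x ∈ M, T x ∈ M) (hN : ∀ x ∈ N, T x ∈ N)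
    (hTM : IsUnit (T.restrict hM : M →L[ℂ] M)) {β : Ordinal}
    (hacc : accIter (κ.spec (T.restrict hN : N →L[ℂ] N)) β ⊆ {0}) :
    (0 : ℂ) ∉ accIter (κ.spec T) (β + 1) := by
  have : CompleteSpace M := h.isClosed.completeSpace_coe
  -- The neighbourhood of `0` used is the resolvent set of `T_M`.
  refine notMem_accIter_add_one (SpectrumKind.isClosed_spec .ordinary _).isOpen_compl ?_
    ((accIter_inter_subset (SpectrumKind.isClosed_spec .ordinary _).isOpen_compl
      (κ.spec_inter_subset h hM hN) β).trans hacc)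
  exact (spectrum.zero_notMem_iff ℂ).2 hTM

theorem HasDecomposition.zero_notMem_accIter {β : Ordinal} (h : HasDecomposition κ β T) :
    (0 : ℂ) ∉ accIter (κ.spec T) (β + 1) := by
  obtain ⟨M, N, hM, hN, hMc, hNc, hMN, hTM, hacc⟩ := h
  exact Submodule.IsTopCompl.zero_notMem_accIter
    (Submodule.isTopCompl_iff_isCompl_isClosed.2 ⟨hMN, hMc, hNc⟩) hM hN hTM hacc

theorem hasDecomposition_of_zero_notMem_accIter {β : Ordinal}
    (h : (0 : ℂ) ∉ accIter (κ.spec T) (β + 1)) : HasDecomposition κ β T := by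
  rw [accIter_add_one, mem_derivedSet, accPt_iff_nhds] at h
  push Not at h
  obtain ⟨U, hU, hU0⟩ := h
  obtain ⟨ε, hε, hεU⟩ := Metric.mem_nhds_iff.1 hU
  have hsub : accIter (κ.spec T) β ∩ Metric.ball 0 ε ⊆ {0} := fun z hz =>
    hU0 z ⟨hεU hz.2, hz.1⟩
  have hcount : (spectrum ℂ T ∩ Metric.ball 0 ε).Countable := by
    refine countable_inter_of_accIter (spectrum.isClosed T) (fun z _ hz hacc => ?_) hsub
    rw [accPt_iff_frequently_nhdsNE] at hacc
    exact hacc (SpectrumKind.eventually_notMem_spectrum hz)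
  obtain ⟨r, hr, hrε, hrT⟩ := exists_sphere_disjoint hε hcount
  obtain ⟨M, N, hM, hN, htop, hTM, hTN⟩ := exists_isTopCompl_of_spectrum_disjoint_sphere hr hrT
  have := htop.isClosed'.completeSpace_coe
  refine ⟨M, N, hM, hN, htop.isClosed, htop.isClosed', htop.isCompl, hTM, fun z hz => ?_⟩
  refine hsub ⟨accIter_mono (κ.spec_restrict_subset htop hM hN) β hz, ?_⟩
  rw [mem_ball_zero_iff]
  exact (hTN z (κ.spec_subset_spectrum _ (accIter_subset (κ.isClosed_spec _) β hz))).trans hrε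

theorem hasDecomposition_sub_smul_one_iff {β : Ordinal} {μ : ℂ} :
    HasDecomposition κ β (T - μ • (1 : X →L[ℂ] X)) ↔ μ ∉ accIter (κ.spec T) (β + 1) := by
  have h : (0 : ℂ) ∈ accIter (κ.spec (T - μ • (1 : X →L[ℂ] X))) (β + 1) ↔
      μ ∈ accIter (κ.spec T) (β + 1) := by
    rw [SpectrumKind.spec_sub_smul_one, accIter_preimage, mem_preimage, Homeomorph.coe_addRight]
    simp only [zero_add]
  rw [← h]
  exact ⟨fun h => h.zero_notMem_accIter, hasDecomposition_of_zero_notMem_accIter⟩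

end Decomposition

theorem mainTheorem2 {X : Type*} [NormedAddCommGroup X] [NormedSpace ℂ X] [CompleteSpace X]
    (κ : SpectrumKind) (T : X →L[ℂ] X) (μ : ℂ) (α : Ordinal) :
    IsGInvertible κ α (T - μ • (1 : X →L[ℂ] X)) ↔ μ ∉ accIter (κ.spec T) α := by
  simp only [IsGInvertible, hasDecomposition_sub_smul_one_iff]
  constructor
  · rintro (⟨rfl, h⟩ | ⟨β, rfl, h⟩ | ⟨hα, γ, hγ, h⟩)
    · rw [accIter_zero]
      rwa [SpectrumKind.zero_mem_spec_sub_smul_one] at h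
    · exact h
    · rw [accIter_limit _ hα]
      exact fun h' => h (mem_iInter₂.1 h' _ hγ)
  · intro h
    induction α using Ordinal.limitRecOn with
    | zero =>
      refine Or.inl ⟨rfl, ?_⟩
      rw [accIter_zero] at h
      rwa [SpectrumKind.zero_mem_spec_sub_smul_one]
    | add_one β _ => exact Or.inr (Or.inl ⟨β, rfl, h⟩)
    | limit α hα _ =>
      rw [accIter_limit _ hα, mem_iInter₂] at h
      push Not at h
      obtain ⟨γ, hγ, h⟩ := h
      -- The index `γ` given by the intersection may fail to be a successor; since `σ_*(T)` is
      -- closed its derivatives decrease, so `γ + 1` serves as well.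
      exact Or.inr (Or.inr ⟨hα, γ, hα.add_one_lt hγ,
        fun h' => h (accIter_add_one_subset (κ.isClosed_spec T) γ h')⟩)
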